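/- Let $f$ be a transcendental entire function with a superattracting fixed point $z_0$ (that is, $f(z_0)=z_0$ and $f'(z_0)=0$), let $f^n$ denote the $n$-th iterate of $f$, and let $p=\min\{n\ge 1: f^{(n)}(z_0)\ne 0\}$. Let $U$ and $V$ be open neighbourhoods of $z_0$ and $0$ with $f(U)\subset U$, and let $\varphi\colon U\to V$ be a conformal bijection with $\varphi(z_0)=0$ and $\varphi(f^n(z))=\varphi(z)^{p^n}$ for all $z\in U$ and $n\in\mathbb N$ (as in Böttcher's theorem). Let $r>0$ be such that $\overline{\mathbb D}_r=\{|w|\le r\}\subset V$, and put $B_r=\varphi^{-1}(\overline{\mathbb D}_r)$ and $D=B_r^\circ\setminus\{z_0\}$. Let $\mathcal K(B_r)$ be the space of nonempty compact subsets of $B_r$ with the Hausdorff metric, and let $H(\mathbb C\setminus\{z_0\})$ be the space of holomorphic functions on $\mathbb C\setminus\{z_0\}$ with the topology of local uniform convergence. For a compact set $K\subset D$ and a function $\omega$ that is continuous on $\bigcup_{n\ge 0}f^n(K)$, a function $g\in H(\mathbb C\setminus\{z_0\})$ is called $C(K)$-universal for the weighted composition operator $W_{\omega,f}\colon g\mapsto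 \omega\cdot(g\circ f)$ if $$\Big\{\prod_{j=0}^{n-1}(\omega\circ f^j)\cdot (g\circ f^n)\Big|_K : n\ge 1\Big\}$$ is dense in $C(K)$ with respect to the uniform norm. Then the following hold. 1. For comeagre many $K\in\mathcal K(B_r)$ one has $K\subset D$ and, for every function $\omega$ that is continuous and non-vanishing on $\bigcup_{n\ge 0}f^n(K)$, comeagre many functions $g\in H(\mathbb C\setminus\{z_0\})$ are $C(K)$-universal for $W_{\omega,f}$. 2. For every function $\omega$ that is continuous and non-vanishing on $D$, comeagre many functions $g\in H(\mathbb C\setminus\{z_0\})$ have the property that comeagre many $K\in\mathcal K(B_r)$ satisfy $K\subset D$ and are such that $g$ is $C(K)$-universal for $W_{\omega,f}$. -/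

import Mathlib

open Set Filter TopologicalSpace

/-- `f` is a transcendental entire function: entire and not a polynomial. -/
def IsTranscendentalEntire (f : ℂ → ℂ) : Prop :=
  Differentiable ℂ f ∧ ¬ ∃ P : Polynomial ℂ, ∀ z, f z = P.eval z

/-- `z₀` is a superattracting fixed point of `f`: a fixed point of multiplier `0`. -/
def IsSuperattractingFixedPt (f : ℂ → ℂ) (z₀ : ℂ) : Prop :=
  f z₀ = z₀ ∧ deriv f z₀ = 0

/-- The smallest `n ≥ 1` with `f⁽ⁿ⁾(z₀) ≠ 0`. -/
noncomputable def localDegree (f : ℂ → ℂ) (z₀ : ℂ) : ℕ :=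
  sInf {n : ℕ | 1 ≤ n ∧ iteratedDeriv n f z₀ ≠ 0}

/-- `φ : U → V` is a Böttcher coordinate of `f` at `z₀`: `U` and `V` are open neighbourhoods of
`z₀` and `0`, `f` maps `U` into itself, and `φ` is a conformal (holomorphic and bijective) map of
`U` onto `V` with `φ (f^n z) = (φ z)^(p^n)` on `U`, where `p` is the local degree. -/
structure IsBottcherCoordinate (f : ℂ → ℂ) (z₀ : ℂ) (U V : Set ℂ) (φ : ℂ → ℂ) : Prop where
  isOpen_source : IsOpen U
  mem_source : z₀ ∈ U
  isOpen_target : IsOpen V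
  zero_mem_target : (0 : ℂ) ∈ V
  mapsTo : MapsTo f U U
  differentiableOn : DifferentiableOn ℂ φ U
  bijOn : BijOn φ U V
  map_fixedPt : φ z₀ = 0
  conj : ∀ z ∈ U, ∀ n : ℕ, φ (f^[n] z) = φ z ^ (localDegree f z₀ ^ n)

/-- `B_r = φ⁻¹(closed disc of radius r about 0)`, where `φ` has domain `U`. -/
def bottcherNhd (U : Set ℂ) (φ : ℂ → ℂ) (r : ℝ) : Set ℂ :=
  {z ∈ U | φ z ∈ Metric.closedBall (0 : ℂ) r}

/-- The space `H(Ω)` of holomorphic functions on `Ω`. As a subspace of `C(Ω, ℂ)` with the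
compact-open topology it carries the topology of local uniform convergence. -/
abbrev HolFun (Ω : Set ℂ) : Type :=
  {g : C(Ω, ℂ) // ∃ G : ℂ → ℂ, DifferentiableOn ℂ G Ω ∧ ∀ z : Ω, g z = G z}

/-- The functions `W_{ω,f}^n g = ∏_{j < n} (ω ∘ f^j) · (g ∘ f^n)` on `M`, for `n = 1, 2, …`,
as elements of `C(M)`; here `g ∈ H(Ω)`, and `f^n` has to map `M` into `Ω`. -/
def weightedOrbit {Ω : Set ℂ} (f ω : ℂ → ℂ) (M : Set ℂ) (g : HolFun Ω) : Set C(M, ℂ) :=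
  {F | ∃ n : ℕ, 1 ≤ n ∧ ∀ z : M, ∃ hz : f^[n] z ∈ Ω,
    F z = (∏ j ∈ Finset.range n, ω (f^[j] z)) * g.1 ⟨f^[n] z, hz⟩}

/-- For a family `𝓕 ⊆ C(M)`, the function `g ∈ H(Ω)` is `𝓕`-universal for `W_{ω,f}`. -/
def IsUniversalFor {Ω : Set ℂ} (f ω : ℂ → ℂ) (M : Set ℂ) (𝓕 : Set C(M, ℂ)) (g : HolFun Ω) :
    Prop :=
  𝓕 ⊆ closure (weightedOrbit f ω M g)

/-- A compact subset of `B`, seen as a subset of the plane. -/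
def planeSet {B : Set ℂ} (K : NonemptyCompacts B) : Set ℂ :=
  Subtype.val '' (K : Set B)

/-- The forward orbit `⋃ n ≥ 0, f^n(M)`, on which the weight of `W_{ω,f}` is evaluated
when the powers of `W_{ω,f}` are formed on `M`. -/
def forwardOrbit (f : ℂ → ℂ) (M : Set ℂ) : Set ℂ :=
  ⋃ n : ℕ, f^[n] '' M

/-! The iterates of compact subsets of the punctured Böttcher disc tend to `z₀`, so the points `(f^n
z - z₀)⁻¹` escape to infinity. Adding `Q (z - z₀)⁻¹` to `g`, with `Q` entire and small on a large
disc, barely changes `g` on a given compact set, while `Q` can still be steered at those far points.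
If `K` is finite and `‖φ ·‖` is injective on `K`, then every `f^n` is injective on `K` and
`exists_entire_interpolation` prescribes all values on `f^n(K)`; such `K` are dense
(`dense_finite_injOn`).

Baire category does the rest. For the first claim, `HasEntireApproximation` does not involve the
weight and holds for comeagre many `K`; it makes the approximation conditions on `g` open and dense.
For the second, comeagre many `g` work for a countable dense family of finite `K`, and for fixed `g`
the conditions are open in `K`.

Transcendence enters through `radius_le_one`: a disc of radius above `1` would force `f` to be a
polynomial. -/

open scoped Topology

/-! ### Injective holomorphic functions -/

theorem nhds_le_map_nhds_of_injOn {φ : ℂ → ℂ} {U : Set ℂ} (hU : IsOpen U)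
    (hd : DifferentiableOn ℂ φ U) (hi : InjOn φ U) {z : ℂ} (hz : z ∈ U) :
    𝓝 (φ z) ≤ map φ (𝓝 z) := by
  have ha : AnalyticAt ℂ φ z := hd.analyticAt (hU.mem_nhds hz)
  refine ha.eventually_constant_or_nhds_le_map_nhds.resolve_left fun h => ?_
  have h1 : ∀ᶠ x in 𝓝[≠] z, φ x = φ z ∧ x ∈ U :=
    (h.and (hU.mem_nhds hz)).filter_mono nhdsWithin_le_nhds
  obtain ⟨x, ⟨h2, h3⟩, h4⟩ := (h1.and self_mem_nhdsWithin).exists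
  exact h4 (hi h3 hz h2)

theorem eventually_deriv_ne_zero_of_injOn {φ : ℂ → ℂ} {U : Set ℂ} (hU : IsOpen U)
    (hd : DifferentiableOn ℂ φ U) (hi : InjOn φ U) {z : ℂ} (hz : z ∈ U) :
    ∀ᶠ x in 𝓝[≠] z, deriv φ x ≠ 0 := by
  have ha : AnalyticAt ℂ φ z := hd.analyticAt (hU.mem_nhds hz)
  refine ha.deriv.eventually_eq_zero_or_eventually_ne_zero.resolve_left fun h => ?_
  obtain ⟨ε, hε, hb⟩ := Metric.eventually_nhds_iff_ball.1 (h.and (hU.mem_nhds hz))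
  have hc : ∀ x ∈ Metric.ball z ε, φ x = φ z := fun x hx =>
    Metric.isOpen_ball.is_const_of_deriv_eq_zero (convex_ball z ε).isPreconnected
      (hd.mono fun y hy => (hb y hy).2) (fun y hy => (hb y hy).1) hx (Metric.mem_ball_self hε)
  have h1 : ∀ᶠ x in 𝓝[≠] z, x ∈ Metric.ball z ε :=
    nhdsWithin_le_nhds (Metric.ball_mem_nhds z hε)
  obtain ⟨x, h2, h3⟩ := (h1.and self_mem_nhdsWithin).exists
  exact h3 (hi (hb x h2).2 hz (hc x h2))

/-- Open mapping makes `ψ` continuous. Zeros of `deriv φ` are isolated, so `ψ` is holomorphic off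
isolated points, which are removable by continuity. -/
theorem differentiable_of_rightInverse {φ ψ : ℂ → ℂ} {U : Set ℂ} (hU : IsOpen U)
    (hd : DifferentiableOn ℂ φ U) (hi : InjOn φ U) (hψU : ∀ w, ψ w ∈ U)
    (hψ : ∀ w, φ (ψ w) = w) : Differentiable ℂ ψ := by
  have hcont : Continuous ψ := by
    refine continuous_iff_continuousAt.2 fun w => ?_
    intro N hN
    have h1 : φ '' (N ∩ U) ∈ 𝓝 w := by
      have := nhds_le_map_nhds_of_injOn hU hd hi (hψU w)
      rw [hψ] at this
      exact this (image_mem_map (inter_mem hN (hU.mem_nhds (hψU w))))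
    refine mem_map.2 (mem_of_superset h1 ?_)
    rintro _ ⟨x, ⟨hxN, hxU⟩, rfl⟩
    have : ψ (φ x) = x := hi (hψU _) hxU (hψ _)
    simpa [this] using hxN
  have hψi : Function.Injective ψ := fun a b h => by rw [← hψ a, ← hψ b, h]
  have hdiff : ∀ w, deriv φ (ψ w) ≠ 0 → DifferentiableAt ℂ ψ w := fun w hw =>
    (HasDerivAt.of_local_left_inverse hcont.continuousAt
      ((hd.differentiableAt (hU.mem_nhds (hψU w))).hasDerivAt) hw
      (Eventually.of_forall hψ)).differentiableAt
  intro w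
  refine (Complex.analyticAt_of_differentiable_on_punctured_nhds_of_continuousAt ?_
    hcont.continuousAt).differentiableAt
  have ht : Tendsto ψ (𝓝[≠] w) (𝓝[≠] (ψ w)) :=
    hcont.continuousAt.continuousWithinAt.tendsto_nhdsWithin fun x hx h => hx (hψi h)
  exact (ht.eventually (eventually_deriv_ne_zero_of_injOn hU hd hi (hψU w))).mono hdiff

/-- Open mapping at `0` and injectivity keep `ψ - ψ 0` away from `0` outside the unit disc. Hence
the entire function `k w = w / (ψ w - ψ 0)` grows at most linearly and is affine by Liouville;
having no zeros, it is constant. -/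
theorem affine_of_entire_injective {ψ : ℂ → ℂ} (hd : Differentiable ℂ ψ)
    (hi : Function.Injective ψ) (h0 : deriv ψ 0 ≠ 0) :
    ∃ a, a ≠ 0 ∧ ∀ w, ψ w = ψ 0 + a * w := by
  have hsd : ∀ g : ℂ → ℂ, Differentiable ℂ g → Differentiable ℂ (dslope g 0) := fun g hg => by
    rw [← differentiableOn_univ] at hg ⊢
    exact (Complex.differentiableOn_dslope univ_mem).2 hg
  have hs0 : ∀ w, dslope ψ 0 w ≠ 0 := by
    intro w
    rcases eq_or_ne w 0 with rfl | hw
    · simpa using h0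
    · rw [dslope_of_ne _ hw, slope_def_field]
      exact div_ne_zero (sub_ne_zero.2 fun h => hw (hi h)) (by simpa using hw)
  have hψs : ∀ w, ψ w = ψ 0 + dslope ψ 0 w * w := fun w => by
    have := sub_smul_dslope ψ 0 w
    simp only [sub_zero, smul_eq_mul] at this
    linear_combination -this
  set k : ℂ → ℂ := fun w => (dslope ψ 0 w)⁻¹ with hk
  have hkd : Differentiable ℂ k := (hsd ψ hd).inv hs0
  have hk0 : ∀ w, k w ≠ 0 := fun w => inv_ne_zero (hs0 w)
  obtain ⟨δ, hδ, hδb⟩ : ∃ δ > 0, ∀ w, 1 ≤ ‖w‖ → δ ≤ ‖ψ w - ψ 0‖ := by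
    have h1 : ψ '' Metric.ball 0 1 ∈ 𝓝 (ψ 0) :=
      nhds_le_map_nhds_of_injOn isOpen_univ hd.differentiableOn hi.injOn (mem_univ 0)
        (image_mem_map (Metric.ball_mem_nhds 0 one_pos))
    obtain ⟨δ, hδ, hb⟩ := Metric.mem_nhds_iff.1 h1
    refine ⟨δ, hδ, fun w hw => ?_⟩
    by_contra! hlt
    obtain ⟨x, hx, hxw⟩ := hb (show ψ w ∈ Metric.ball (ψ 0) δ by simpa [dist_eq_norm] using hlt)
    rw [hi hxw] at hx
    simp only [Metric.mem_ball, dist_zero_right] at hx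
    linarith
  obtain ⟨C, hC⟩ := (isCompact_closedBall (0 : ℂ) 1).exists_bound_of_continuousOn
    (hsd k hkd).continuous.continuousOn
  have hbdd : Bornology.IsBounded (range (dslope k 0)) := by
    refine isBounded_iff_forall_norm_le.2 ⟨max C (1 / δ + ‖k 0‖), ?_⟩
    rintro _ ⟨w, rfl⟩
    rcases le_total ‖w‖ 1 with hw | hw
    · exact (hC w (by simpa using hw)).trans (le_max_left _ _)
    · refine le_trans ?_ (le_max_right _ _)
      have hw0 : w ≠ 0 := by rintro rfl; simp at hw; linarith
      have hwp : 0 < ‖w‖ := norm_pos_iff.2 hw0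
      rw [dslope_of_ne _ hw0, slope_def_field, sub_zero, sub_div]
      refine (norm_sub_le _ _).trans (add_le_add ?_ ?_)
      · have : k w / w = (ψ w - ψ 0)⁻¹ := by
          rw [hψs w]; simp only [hk, add_sub_cancel_left, mul_inv, div_eq_mul_inv]
        rw [this, norm_inv, one_div]
        exact inv_anti₀ hδ (hδb w hw)
      · rw [norm_div]; exact div_le_self (norm_nonneg _) hw
  have hconst : ∀ w, k w = k 0 + dslope k 0 0 * w := fun w => by
    have := sub_smul_dslope k 0 w
    rw [(hsd k hkd).apply_eq_apply_of_bounded hbdd w 0] at this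
    simp only [sub_zero, smul_eq_mul] at this
    linear_combination -this
  have hc : dslope k 0 0 = 0 := by
    by_contra hne
    refine hk0 (-k 0 / dslope k 0 0) ?_
    rw [hconst]; field_simp; ring
  refine ⟨dslope ψ 0 0, hs0 0, fun w => ?_⟩
  have : k w = k 0 := by rw [hconst w, hc]; ring
  rw [hψs w, inv_injective this]

/-! ### The bound on the radius -/

namespace IsBottcherCoordinate

variable {f : ℂ → ℂ} {z₀ : ℂ} {U V : Set ℂ} {φ : ℂ → ℂ}

theorem two_le_localDegree (hφ : IsBottcherCoordinate f z₀ U V φ)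
    (hz₀ : IsSuperattractingFixedPt f z₀) : 2 ≤ localDegree f z₀ := by
  -- The infimum of the empty set is `0`. With that exponent the functional equation at `z₀` would
  -- read `0 = 0 ^ 0 = 1`.
  have h0 : localDegree f z₀ ≠ 0 := by
    intro h
    have := hφ.conj z₀ hφ.mem_source 1
    simp [hz₀.1, hφ.map_fixedPt, h] at this
  have hmem : localDegree f z₀ ∈ {n : ℕ | 1 ≤ n ∧ iteratedDeriv n f z₀ ≠ 0} := by
    refine Nat.sInf_mem ?_
    by_contra hne
    rw [not_nonempty_iff_eq_empty] at hne
    exact h0 (by rw [localDegree, hne, Nat.sInf_empty])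
  have h1 : localDegree f z₀ ≠ 1 := by
    intro h
    rw [h] at hmem
    exact hmem.2 (by rw [iteratedDeriv_one]; exact hz₀.2)
  omega

theorem iterate_mem (hφ : IsBottcherCoordinate f z₀ U V φ) {z : ℂ} (hz : z ∈ U) (n : ℕ) :
    f^[n] z ∈ U := hφ.mapsTo.iterate n hz

/-- If `r > 1`, every `w` is a `p^n`-th power of some `v` with `‖v‖ ≤ r`, so `w = φ (f^[n] z)` lies
in `V`. Then `V` is the plane, the inverse of `φ` is entire and injective, hence affine, and `f` is
conjugate to a power by an affine map. -/
theorem radius_le_one (hφ : IsBottcherCoordinate f z₀ U V φ) (hf : IsTranscendentalEntire f)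
    (hz₀ : IsSuperattractingFixedPt f z₀) {r : ℝ} (hrV : Metric.closedBall (0 : ℂ) r ⊆ V) :
    r ≤ 1 := by
  by_contra! hr
  have hp := hφ.two_le_localDegree hz₀
  have hV : ∀ w, w ∈ V := by
    intro w
    obtain ⟨n, hn⟩ : ∃ n : ℕ, ‖w‖ ≤ r ^ (localDegree f z₀ ^ n) := by
      obtain ⟨n, hn⟩ := pow_unbounded_of_one_lt ‖w‖ hr
      exact ⟨n, hn.le.trans (pow_le_pow_right₀ hr.le (Nat.lt_pow_self hp).le)⟩
    have hpn : localDegree f z₀ ^ n ≠ 0 := pow_ne_zero _ (by omega)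
    obtain ⟨v, rfl⟩ := IsAlgClosed.exists_pow_nat_eq w (Nat.pos_of_ne_zero hpn)
    have hv : ‖v‖ ≤ r := by
      rw [norm_pow] at hn
      exact le_of_pow_le_pow_left₀ hpn (by linarith) hn
    obtain ⟨z, hz, rfl⟩ := hφ.bijOn.surjOn (hrV (show v ∈ Metric.closedBall 0 r by simpa using hv))
    rw [← hφ.conj z hz n]
    exact hφ.bijOn.mapsTo (hφ.iterate_mem hz n)
  choose ψ hψU hψ using fun w => hφ.bijOn.surjOn (hV w)
  have hψd := differentiable_of_rightInverse hφ.isOpen_source hφ.differentiableOn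
    hφ.bijOn.injOn hψU hψ
  have hψi : Function.Injective ψ := fun a b h => by rw [← hψ a, ← hψ b, h]
  have hψ0 : deriv ψ 0 ≠ 0 := by
    intro h
    have h1 := ((hφ.differentiableOn.differentiableAt
      (hφ.isOpen_source.mem_nhds (hψU 0))).hasDerivAt).comp 0 (hψd 0).hasDerivAt
    have h2 : φ ∘ ψ = id := funext hψ
    rw [h2, h, mul_zero] at h1
    exact zero_ne_one (h1.unique (hasDerivAt_id 0))
  obtain ⟨a, ha, haff⟩ := affine_of_entire_injective hψd hψi hψ0
  have hφa : ∀ z, z ∈ U ∧ φ z = a⁻¹ * (z - ψ 0) := by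
    intro z
    have h1 : ψ (a⁻¹ * (z - ψ 0)) = z := by rw [haff]; field_simp; ring
    exact ⟨h1 ▸ hψU _, by conv_lhs => rw [← h1, hψ]⟩
  refine hf.2 ⟨Polynomial.C (ψ 0) + Polynomial.C a *
    (Polynomial.C a⁻¹ * (Polynomial.X - Polynomial.C (ψ 0))) ^ localDegree f z₀, fun z => ?_⟩
  have h1 := hφ.conj z (hφa z).1 1
  simp only [Function.iterate_one, pow_one, (hφa _).2] at h1
  simp only [Polynomial.eval_add, Polynomial.eval_C, Polynomial.eval_mul, Polynomial.eval_pow,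
    Polynomial.eval_sub, Polynomial.eval_X, ← h1]
  field_simp; ring

end IsBottcherCoordinate

/-! ### Dynamics on the punctured Böttcher disc -/

/-- The points of `U` whose image under `φ` is in the punctured open disc of radius `r`. -/
def puncturedNhd (U : Set ℂ) (φ : ℂ → ℂ) (r : ℝ) : Set ℂ :=
  {z ∈ U | φ z ≠ 0 ∧ ‖φ z‖ < r}

namespace IsBottcherCoordinate

variable {f : ℂ → ℂ} {z₀ : ℂ} {U V : Set ℂ} {φ : ℂ → ℂ} {r : ℝ}

theorem isOpen_puncturedNhd (hφ : IsBottcherCoordinate f z₀ U V φ) (r : ℝ) :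
    IsOpen (puncturedNhd U φ r) := by
  have : puncturedNhd U φ r = U ∩ φ ⁻¹' ({0}ᶜ ∩ Metric.ball 0 r) := by
    ext z; simp [puncturedNhd]; tauto
  rw [this]
  exact hφ.differentiableOn.continuousOn.isOpen_inter_preimage hφ.isOpen_source
    (isOpen_compl_singleton.inter Metric.isOpen_ball)

theorem puncturedNhd_subset (hφ : IsBottcherCoordinate f z₀ U V φ) (r : ℝ) :
    puncturedNhd U φ r ⊆ interior (bottcherNhd U φ r) \ {z₀} := by
  refine fun z hz => ⟨interior_maximal ?_ (hφ.isOpen_puncturedNhd r) hz, ?_⟩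
  · exact fun w hw => ⟨hw.1, by simpa using hw.2.2.le⟩
  · rintro rfl
    exact hz.2.1 hφ.map_fixedPt

theorem iterate_ne (hφ : IsBottcherCoordinate f z₀ U V φ) {z : ℂ}
    (hz : z ∈ puncturedNhd U φ r) (n : ℕ) : f^[n] z ≠ z₀ := by
  intro h
  have := hφ.conj z hz.1 n
  rw [h, hφ.map_fixedPt] at this
  exact pow_ne_zero _ hz.2.1 this.symm

theorem iterate_mem_puncturedNhd (hφ : IsBottcherCoordinate f z₀ U V φ) (hr : r ≤ 1)
    (hp : localDegree f z₀ ≠ 0) {z : ℂ}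
    (hz : z ∈ puncturedNhd U φ r) (n : ℕ) : f^[n] z ∈ puncturedNhd U φ r := by
  refine ⟨hφ.iterate_mem hz.1 n, ?_⟩
  rw [hφ.conj z hz.1 n]
  refine ⟨pow_ne_zero _ hz.2.1, ?_⟩
  rw [norm_pow]
  exact (pow_le_of_le_one (norm_nonneg _) (hz.2.2.le.trans hr) (pow_ne_zero _ hp)).trans_lt hz.2.2

theorem eventually_iterate_near (hφ : IsBottcherCoordinate f z₀ U V φ) (hr : r ≤ 1)
    (hp : 2 ≤ localDegree f z₀) {M : Set ℂ} (hM : IsCompact M) (hMr : M ⊆ puncturedNhd U φ r)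
    {ε : ℝ} (hε : 0 < ε) : ∀ᶠ n in atTop, ∀ z ∈ M, ‖f^[n] z - z₀‖ < ε := by
  rcases M.eq_empty_or_nonempty with rfl | hne
  · simp
  obtain ⟨x, hx, hmax⟩ := hM.exists_isMaxOn hne
    (hφ.differentiableOn.continuousOn.mono fun z hz => (hMr hz).1).norm
  have h1 : φ '' (Metric.ball z₀ ε ∩ U) ∈ 𝓝 (φ z₀) :=
    nhds_le_map_nhds_of_injOn hφ.isOpen_source hφ.differentiableOn hφ.bijOn.injOn hφ.mem_source
      (image_mem_map (inter_mem (Metric.ball_mem_nhds _ hε)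
        (hφ.isOpen_source.mem_nhds hφ.mem_source)))
  rw [hφ.map_fixedPt] at h1
  obtain ⟨δ, hδ, hb⟩ := Metric.mem_nhds_iff.1 h1
  have hx1 : ‖φ x‖ < 1 := (hMr hx).2.2.trans_le hr
  filter_upwards [(tendsto_pow_atTop_nhds_zero_of_lt_one (norm_nonneg _) hx1).eventually_lt_const hδ]
    with n hn z hz
  have h2 : ‖φ (f^[n] z)‖ < δ := by
    rw [hφ.conj z (hMr hz).1 n, norm_pow]
    calc ‖φ z‖ ^ (localDegree f z₀ ^ n) ≤ ‖φ z‖ ^ n :=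
          pow_le_pow_of_le_one (norm_nonneg _) ((hMr hz).2.2.le.trans hr)
            (Nat.lt_pow_self hp).le
      _ ≤ ‖φ x‖ ^ n := pow_le_pow_left₀ (norm_nonneg _) (hmax hz) n
      _ < δ := hn
  obtain ⟨y, ⟨hy, hyU⟩, hyφ⟩ := hb (show φ (f^[n] z) ∈ Metric.ball 0 δ by simpa using h2)
  rw [hφ.bijOn.injOn hyU (hφ.iterate_mem (hMr hz).1 n) hyφ] at hy
  simpa [dist_eq_norm] using hy

/-- A power of `φ z` determines `‖φ z‖`, though not `φ z` itself; hence the hypothesis on the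
modulus. -/
theorem injOn_iterate (hφ : IsBottcherCoordinate f z₀ U V φ) (hp : localDegree f z₀ ≠ 0)
    {M : Set ℂ} (hMU : M ⊆ U) (hi : InjOn (fun z => ‖φ z‖) M) (n : ℕ) : InjOn f^[n] M := by
  intro x hx y hy h
  refine hi hx hy ?_
  have h1 : ‖φ x‖ ^ (localDegree f z₀ ^ n) = ‖φ y‖ ^ (localDegree f z₀ ^ n) := by
    rw [← norm_pow, ← norm_pow, ← hφ.conj x (hMU hx) n, ← hφ.conj y (hMU hy) n, h]
  exact (pow_left_inj₀ (norm_nonneg _) (norm_nonneg _) (pow_ne_zero _ hp)).1 h1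

/-! ### Density of finite sets with distinct moduli -/

theorem exists_near_of_finite (hφ : IsBottcherCoordinate f z₀ U V φ) (hr : 0 < r)
    {S : Set ℝ} (hS : S.Finite) (x : bottcherNhd U φ r) {ε : ℝ} (hε : 0 < ε) :
    ∃ y : bottcherNhd U φ r, dist x y < ε ∧ (y : ℂ) ∈ puncturedNhd U φ r ∧ ‖φ y‖ ∉ S := by
  obtain ⟨x, hxU, hxr⟩ := x
  have h1 : φ '' (Metric.ball x ε ∩ U) ∈ 𝓝 (φ x) :=
    nhds_le_map_nhds_of_injOn hφ.isOpen_source hφ.differentiableOn hφ.bijOn.injOn hxU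
      (image_mem_map (inter_mem (Metric.ball_mem_nhds _ hε) (hφ.isOpen_source.mem_nhds hxU)))
  -- The point `φ x` is moved along its ray. For `φ x = 0` the convention `arg 0 = 0` selects the
  -- positive axis.
  set e : ℂ := Complex.exp (Complex.arg (φ x) * Complex.I) with he
  have he1 : ‖e‖ = 1 := Complex.norm_exp_ofReal_mul_I _
  have h2 : (fun s : ℝ => (s : ℂ) * e) ⁻¹' (φ '' (Metric.ball x ε ∩ U)) ∈ 𝓝 ‖φ x‖ := by
    have hc : Continuous fun s : ℝ => (s : ℂ) * e := by fun_prop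
    refine hc.continuousAt ?_
    convert h1
    exact Complex.norm_mul_exp_arg_mul_I _
  have h3 : ‖φ x‖ ∈ closure (Ioo 0 r ∩ Sᶜ) := by
    have hd : Dense Sᶜ := hS.countable.dense_compl ℝ
    refine closure_minimal (hd.open_subset_closure_inter isOpen_Ioo) isClosed_closure ?_
    rw [closure_Ioo hr.ne]
    exact ⟨norm_nonneg _, by simpa using hxr⟩
  obtain ⟨s, ⟨y, ⟨hy, hyU⟩, hys⟩, ⟨hs0, hsr⟩, hsS⟩ := mem_closure_iff_nhds.1 h3 _ h2
  have hn : ‖φ y‖ = s := by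
    rw [hys]; simp [he1, abs_of_pos hs0]
  refine ⟨⟨y, hyU, by simpa [hn] using hsr.le⟩, ?_, ⟨hyU, ?_, ?_⟩, ?_⟩
  · rw [dist_comm]; exact hy
  · rw [← norm_ne_zero_iff, hn]; exact hs0.ne'
  · rw [hn]; exact hsr
  · rw [hn]; exact hsS

theorem exists_perturbation (hφ : IsBottcherCoordinate f z₀ U V φ) (hr : 0 < r)
    {ε : ℝ} (hε : 0 < ε) (s : Finset (bottcherNhd U φ r)) :
    ∃ g : bottcherNhd U φ r → bottcherNhd U φ r, (∀ x ∈ s, dist x (g x) < ε) ∧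
      (∀ x ∈ s, (g x : ℂ) ∈ puncturedNhd U φ r) ∧ InjOn (fun x => ‖φ (g x)‖) s := by
  classical
  induction s using Finset.induction_on with
  | empty => exact ⟨id, by simp⟩
  | insert a s ha ih =>
    obtain ⟨g, h1, h2, h3⟩ := ih
    obtain ⟨y, hy1, hy2, hy3⟩ := hφ.exists_near_of_finite hr
      (s.finite_toSet.image fun x => ‖φ (g x)‖) a hε
    have hne : ∀ x ∈ s, x ≠ a := fun x hx h => ha (h ▸ hx)
    refine ⟨Function.update g a y, ?_, ?_, ?_⟩
    · intro x hx
      rcases Finset.mem_insert.1 hx with rfl | hx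
      · simpa using hy1
      · simpa [Function.update_of_ne (hne x hx)] using h1 x hx
    · intro x hx
      rcases Finset.mem_insert.1 hx with rfl | hx
      · simpa using hy2
      · simpa [Function.update_of_ne (hne x hx)] using h2 x hx
    · rw [Finset.coe_insert, injOn_insert (by simpa using ha)]
      have heq : EqOn (fun x => ‖φ (Function.update g a y x)‖) (fun x => ‖φ (g x)‖) s :=
        fun x hx => by simp [Function.update_of_ne (hne x hx)]
      refine ⟨heq.injOn_iff.2 h3, ?_⟩
      rw [heq.image_eq]
      simpa using hy3

/-- The finite sets in `puncturedNhd U φ r` on which `‖φ ·‖` is injective are dense. -/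
theorem dense_finite_injOn (hφ : IsBottcherCoordinate f z₀ U V φ) (hr : 0 < r) :
    Dense {K : NonemptyCompacts (bottcherNhd U φ r) | (planeSet K).Finite ∧
      planeSet K ⊆ puncturedNhd U φ r ∧ InjOn (fun z => ‖φ z‖) (planeSet K)} := by
  rw [Metric.dense_iff]
  intro K ε hε
  obtain ⟨K', hK', hK'f⟩ := (Metric.dense_iff.1
    (NonemptyCompacts.dense_setOfPred_finite (α := bottcherNhd U φ r))) K (ε / 2) (half_pos hε)
  obtain ⟨g, h1, h2, h3⟩ := hφ.exists_perturbation hr (half_pos (half_pos hε)) hK'f.toFinset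
  simp only [Set.Finite.mem_toFinset, Set.Finite.coe_toFinset] at h1 h2 h3
  have hfin : (g '' (K' : Set _)).Finite := Set.Finite.image g hK'f
  refine ⟨⟨⟨g '' (K' : Set _), hfin.isCompact⟩, K'.nonempty.image g⟩, ?_, ?_, ?_, ?_⟩
  · rw [Metric.mem_ball] at hK' ⊢
    refine (dist_triangle _ K' _).trans_lt ?_
    have : dist (⟨⟨g '' (K' : Set _), hfin.isCompact⟩, K'.nonempty.image g⟩ :
        NonemptyCompacts (bottcherNhd U φ r)) K' ≤ ε / 2 / 2 := by
      rw [_root_.Metric.NonemptyCompacts.dist_eq]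
      refine Metric.hausdorffDist_le_of_mem_dist (by positivity) ?_ ?_
      · rintro _ ⟨x, hx, rfl⟩
        exact ⟨x, hx, by rw [dist_comm]; exact (h1 x hx).le⟩
      · exact fun x hx => ⟨g x, ⟨x, hx, rfl⟩, (h1 x hx).le⟩
    linarith
  · exact hfin.image _
  · rintro _ ⟨_, ⟨x, hx, rfl⟩, rfl⟩
    exact h2 x hx
  · rintro _ ⟨_, ⟨x, hx, rfl⟩, rfl⟩ _ ⟨_, ⟨y, hy, rfl⟩, rfl⟩ h
    rw [h3 hx hy h]

end IsBottcherCoordinate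

/-! ### Category and approximation tools -/

theorem isOpen_setOf_planeSet_subset {B O : Set ℂ} (hO : IsOpen O) :
    IsOpen {K : NonemptyCompacts B | planeSet K ⊆ O} := by
  have : {K : NonemptyCompacts B | planeSet K ⊆ O} =
      {K : NonemptyCompacts B | (K : Set B) ⊆ Subtype.val ⁻¹' O} := by
    ext K; simp [planeSet]
  rw [this]
  exact NonemptyCompacts.isOpen_subsets_of_isOpen (hO.preimage continuous_subtype_val)

theorem isCompact_planeSet {B : Set ℂ} (K : NonemptyCompacts B) : IsCompact (planeSet K) :=
  K.isCompact.image continuous_subtype_val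

/-- The set `T ∪ (closure T)ᶜ` is open and dense. This handles conditions that need only hold for
those `K` with `f^n(K)` already close to `z₀`. -/
theorem eventually_residual_imp {X : Type*} [TopologicalSpace X] {S T : Set X}
    (hT : IsOpen T) (h : S ⊆ closure T) : ∀ᶠ x in residual X, x ∈ S → x ∈ T := by
  have h1 : T ∪ (closure T)ᶜ ∈ residual X := by
    refine residual_of_dense_open (hT.union isClosed_closure.isOpen_compl) ?_
    rw [dense_iff_closure_eq, closure_union, eq_univ_iff_forall]
    intro x
    by_cases hx : x ∈ closure T
    · exact Or.inl hx
    · exact Or.inr (subset_closure hx)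
  filter_upwards [h1] with x hx hxS
  exact hx.resolve_right fun hx' => hx' (h hxS)

/-- A countable family of continuous functions on the plane approximates every continuous
function on every compact set. -/
theorem exists_seq_approx (F : C(ℂ, ℂ)) {M : Set ℂ} (hM : IsCompact M) {ε : ℝ} (hε : 0 < ε) :
    ∃ k, ∀ z ∈ M, ‖denseSeq C(ℂ, ℂ) k z - F z‖ < ε := by
  have : CompactSpace M := isCompact_iff_compactSpace.1 hM
  have hO : IsOpen {G : C(ℂ, ℂ) | dist (G.restrict M) (F.restrict M) < ε} :=
    isOpen_lt ((ContinuousMap.continuous_restrict M).dist continuous_const) continuous_const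
  obtain ⟨G, hG, k, rfl⟩ := (denseRange_denseSeq C(ℂ, ℂ)).inter_open_nonempty _ hO
    ⟨F, by simpa using hε⟩
  refine ⟨k, fun z hz => ?_⟩
  rw [← dist_eq_norm]
  exact (ContinuousMap.dist_lt_iff hε).1 hG ⟨z, hz⟩

/-- A new node `e` is met by adding `q ζ * (ζ / e) ^ N`, where `q` vanishes at the old nodes and
corrects the value at `e`. Since `‖ζ / e‖ ≤ m / ‖e‖ < 1` on the disc, a large `N` makes the
correction small there. -/
theorem exists_entire_interpolation (a : ℂ → ℂ) {m : ℝ} (hm : 0 ≤ m) (E : Finset ℂ) :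
    (∀ e ∈ E, m < ‖e‖) → ∀ ε > 0, ∃ Q : ℂ → ℂ, Differentiable ℂ Q ∧ (∀ e ∈ E, Q e = a e) ∧
      ∀ ζ, ‖ζ‖ ≤ m → ‖Q ζ‖ < ε := by
  classical
  induction E using Finset.induction_on with
  | empty => exact fun _ ε hε => ⟨0, differentiable_const 0, by simp, by simpa using fun _ _ => hε⟩
  | insert e E he ih =>
    intro hE ε hε
    obtain ⟨Q, hQd, hQe, hQb⟩ := ih (fun x hx => hE x (Finset.mem_insert_of_mem hx)) _ (half_pos hε)
    have hem := hE e (Finset.mem_insert_self _ _)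
    have he0 : e ≠ 0 := norm_pos_iff.1 (hm.trans_lt hem)
    have hprod : ∏ j ∈ E, (e - j) ≠ 0 :=
      Finset.prod_ne_zero_iff.2 fun j hj => sub_ne_zero.2 fun h => he (h ▸ hj)
    set q : ℂ → ℂ := fun ζ => (a e - Q e) / (∏ j ∈ E, (e - j)) * ∏ j ∈ E, (ζ - j) with hq
    have hqd : Differentiable ℂ q := by fun_prop
    obtain ⟨C, hC⟩ := (isCompact_closedBall (0 : ℂ) m).exists_bound_of_continuousOn
      hqd.continuous.continuousOn
    have hlt : m / ‖e‖ < 1 := (div_lt_one (hm.trans_lt hem)).2 hem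
    have ht : Tendsto (fun N : ℕ => C * (m / ‖e‖) ^ N) atTop (𝓝 (C * 0)) :=
      (tendsto_pow_atTop_nhds_zero_of_lt_one (by positivity) hlt).const_mul C
    rw [mul_zero] at ht
    obtain ⟨N, hN⟩ := (ht.eventually_lt_const (half_pos hε)).exists
    refine ⟨fun ζ => Q ζ + q ζ * (ζ / e) ^ N, by fun_prop, ?_, ?_⟩
    · intro x hx
      rcases Finset.mem_insert.1 hx with rfl | hx
      · simp only [hq]; rw [div_self he0, one_pow]; field_simp; ring
      · simp [hq, Finset.prod_eq_zero hx (sub_self x), hQe x hx]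
    · intro ζ hζ
      have hCζ := hC ζ (by simpa using hζ)
      have : ‖q ζ * (ζ / e) ^ N‖ ≤ C * (m / ‖e‖) ^ N := by
        rw [norm_mul, norm_pow, norm_div]
        gcongr
        exact (norm_nonneg _).trans hCζ
      linarith [norm_add_le (Q ζ) (q ζ * (ζ / e) ^ N), hQb ζ hζ]

/-- Every continuous function on `M` is approximated, after transport by `f^n`, by functions
`z ↦ Q (z - z₀)⁻¹` with `Q` entire and small on a disc, as soon as `f^n(M)` is near `z₀`. -/
def HasEntireApproximation (f : ℂ → ℂ) (z₀ : ℂ) (M : Set ℂ) : Prop :=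
  ∀ n m : ℕ, (∀ z ∈ M, ‖f^[n] z - z₀‖ * m < 1) → ∀ F : C(ℂ, ℂ), ∀ ε > 0,
    ∃ Q : ℂ → ℂ, Differentiable ℂ Q ∧ (∀ ζ, ‖ζ‖ ≤ m → ‖Q ζ‖ < ε) ∧
      ∀ z ∈ M, ‖Q (f^[n] z - z₀)⁻¹ - F z‖ < ε

/-- The nodes `(f^[n] z - z₀)⁻¹` are distinct and lie outside the disc of radius `m`, so
interpolation is exact. -/
theorem hasEntireApproximation_of_finite {f : ℂ → ℂ} {z₀ : ℂ} {M : Set ℂ} (hM : M.Finite)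
    (hi : ∀ n : ℕ, InjOn f^[n] M) (hne : ∀ z ∈ M, ∀ n : ℕ, f^[n] z ≠ z₀) :
    HasEntireApproximation f z₀ M := by
  intro n m hm F ε hε
  set c : ℂ → ℂ := fun z => (f^[n] z - z₀)⁻¹ with hc
  have hci : InjOn c M := fun x hx y hy h => hi n hx hy (sub_left_injective (inv_injective h))
  obtain ⟨Q, hQ, hQe, hQb⟩ := exists_entire_interpolation (fun ζ => F (Function.invFunOn c M ζ)) m.cast_nonneg
    (hM.image c).toFinset (by
      intro e he
      obtain ⟨z, hz, rfl⟩ := (hM.image c).mem_toFinset.1 he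
      have : 0 < ‖f^[n] z - z₀‖ := norm_pos_iff.2 (sub_ne_zero.2 (hne z hz n))
      rw [hc, norm_inv, inv_eq_one_div, lt_div_iff₀ this, mul_comm]
      exact hm z hz) ε hε
  refine ⟨Q, hQ, hQb, fun z hz => ?_⟩
  have := hQe (c z) ((hM.image c).mem_toFinset.2 ⟨z, hz, rfl⟩)
  rw [hci.leftInvOn_invFunOn hz] at this
  simpa [hc] using show ‖Q (c z) - F z‖ < ε by simpa [this] using hε

theorem HasEntireApproximation.of_seq {f : ℂ → ℂ} {z₀ : ℂ} {M : Set ℂ} (hM : IsCompact M)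
    (h : ∀ n m k j : ℕ, (∀ z ∈ M, ‖f^[n] z - z₀‖ * m < 1) →
      ∃ Q : ℂ → ℂ, Differentiable ℂ Q ∧ (∀ ζ, ‖ζ‖ ≤ m → ‖Q ζ‖ < 1 / ((j : ℝ) + 1)) ∧
        ∀ z ∈ M, ‖Q (f^[n] z - z₀)⁻¹ - denseSeq C(ℂ, ℂ) k z‖ < 1 / ((j : ℝ) + 1)) :
    HasEntireApproximation f z₀ M := by
  intro n m hm F ε hε
  obtain ⟨k, hk⟩ := exists_seq_approx F hM (half_pos hε)
  obtain ⟨j, hj⟩ := exists_nat_one_div_lt (half_pos hε)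
  obtain ⟨Q, hQ, h1, h2⟩ := h n m k j hm
  refine ⟨Q, hQ, fun ζ hζ => by linarith [h1 ζ hζ], fun z hz => ?_⟩
  have := norm_sub_le_norm_sub_add_norm_sub (Q (f^[n] z - z₀)⁻¹) (denseSeq C(ℂ, ℂ) k z) (F z)
  linarith [h2 z hz, hk z hz]

/-- The function `z ↦ g z + Q (z - z₀)⁻¹`. -/
noncomputable def HolFun.addEntire {z₀ : ℂ} (g : HolFun ({z₀}ᶜ : Set ℂ)) (Q : ℂ → ℂ)
    (hQ : Differentiable ℂ Q) : HolFun ({z₀}ᶜ : Set ℂ) :=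
  ⟨⟨fun z => g.1 z + Q ((z : ℂ) - z₀)⁻¹, by
      refine g.1.continuous.add (hQ.continuous.comp (Continuous.inv₀ (by fun_prop) fun z => ?_))
      exact sub_ne_zero.2 z.2⟩, by
    obtain ⟨G, hG, hgG⟩ := g.2
    refine ⟨fun z => G z + Q (z - z₀)⁻¹, hG.add (hQ.comp_differentiableOn ?_), fun z => ?_⟩
    · exact DifferentiableOn.inv (by fun_prop) fun z hz => sub_ne_zero.2 hz
    · simp [hgG]⟩

theorem HolFun.addEntire_apply {z₀ : ℂ} (g : HolFun ({z₀}ᶜ : Set ℂ)) (Q : ℂ → ℂ)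
    (hQ : Differentiable ℂ Q) (z : ({z₀}ᶜ : Set ℂ)) :
    (g.addEntire Q hQ).1 z = g.1 z + Q ((z : ℂ) - z₀)⁻¹ := rfl

/-- On a compact subset of the punctured plane `(z - z₀)⁻¹` is bounded, so it lies in the disc of
radius `m` for all large `m`. -/
theorem HolFun.mem_closure_of_addEntire {z₀ : ℂ} {g : HolFun ({z₀}ᶜ : Set ℂ)}
    {S : Set (HolFun ({z₀}ᶜ : Set ℂ))}
    (h : ∀ m : ℕ, ∃ Q : ℂ → ℂ, ∃ hQ : Differentiable ℂ Q,
      (∀ ζ, ‖ζ‖ ≤ m → ‖Q ζ‖ < 1 / ((m : ℝ) + 1)) ∧ g.addEntire Q hQ ∈ S) : g ∈ closure S := by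
  choose Q hQ hQb hS using h
  refine mem_closure_of_tendsto (f := fun m => g.addEntire (Q m) (hQ m)) (b := atTop) ?_
    (Eventually.of_forall hS)
  rw [tendsto_subtype_rng, ContinuousMap.tendsto_iff_forall_isCompact_tendstoUniformlyOn]
  intro L hL
  rw [Metric.tendstoUniformlyOn_iff]
  intro ε hε
  obtain ⟨C, hC⟩ := hL.exists_bound_of_continuousOn
    (f := fun z : ({z₀}ᶜ : Set ℂ) => ((z : ℂ) - z₀)⁻¹)
    (Continuous.inv₀ (by fun_prop) fun z => sub_ne_zero.2 z.2).continuousOn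
  obtain ⟨j, hj⟩ := exists_nat_one_div_lt hε
  obtain ⟨i, hi⟩ := exists_nat_ge C
  filter_upwards [eventually_ge_atTop (max i j)] with m hm z hz
  have h1 : ((i : ℕ) : ℝ) ≤ m := by exact_mod_cast (le_max_left i j).trans hm
  have h2 : ((j : ℕ) : ℝ) ≤ m := by exact_mod_cast (le_max_right i j).trans hm
  rw [dist_comm, dist_eq_norm, HolFun.addEntire_apply, add_sub_cancel_left]
  refine (hQb m _ (((hC z hz).trans hi).trans h1)).trans (lt_of_le_of_lt ?_ hj)
  gcongr

/-! ### Universality as countably many open dense conditions -/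

/-- Some power of the weighted composition operator maps `g` within `ε` of `F` on `M`. -/
def ApproximatedByOrbit (f ω : ℂ → ℂ) {Ω : Set ℂ} (M : Set ℂ) (g : HolFun Ω) (F : C(ℂ, ℂ))
    (ε : ℝ) : Prop :=
  ∃ n : ℕ, 1 ≤ n ∧ ∀ z ∈ M, ∃ hz : f^[n] z ∈ Ω,
    ‖(∏ j ∈ Finset.range n, ω (f^[j] z)) * g.1 ⟨f^[n] z, hz⟩ - F z‖ < ε

section weights

variable {f ω : ℂ → ℂ} {z₀ : ℂ} {M : Set ℂ}

theorem continuousOn_weight (hf : Continuous f) (hω : ContinuousOn ω (forwardOrbit f M)) (n : ℕ) :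
    ContinuousOn (fun z => ∏ j ∈ Finset.range n, ω (f^[j] z)) M :=
  continuousOn_finsetProd _ fun j _ => hω.comp (hf.iterate j).continuousOn
    fun z hz => mem_iUnion.2 ⟨j, z, hz, rfl⟩

theorem isUniversalFor_of_seq (hf : Continuous f) (hM : IsCompact M)
    (hω : ContinuousOn ω (forwardOrbit f M)) {Ω : Set ℂ} {g : HolFun Ω}
    (h : ∀ k j : ℕ, ApproximatedByOrbit f ω M g (denseSeq C(ℂ, ℂ) k) (1 / ((j : ℝ) + 1))) :
    IsUniversalFor f ω M univ g := by
  have : CompactSpace M := isCompact_iff_compactSpace.1 hM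
  intro P _
  rw [Metric.mem_closure_iff]
  intro ε hε
  obtain ⟨F, rfl⟩ := ContinuousMap.exists_restrict_eq hM.isClosed P
  obtain ⟨k, hk⟩ := exists_seq_approx F hM (half_pos hε)
  obtain ⟨j, hj⟩ := exists_nat_one_div_lt (half_pos hε)
  obtain ⟨n, hn, hz⟩ := h k j
  choose hΩ hb using hz
  have hc : Continuous fun z : M =>
      (∏ j ∈ Finset.range n, ω (f^[j] z)) * g.1 ⟨f^[n] z, hΩ z z.2⟩ :=
    (continuousOn_iff_continuous_domRestrict.1 (continuousOn_weight hf hω n)).mul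
      (g.1.continuous.comp (((hf.iterate n).comp continuous_subtype_val).subtype_mk _))
  refine ⟨⟨_, hc⟩, ⟨n, hn, fun z => ⟨hΩ z z.2, rfl⟩⟩, ?_⟩
  rw [dist_comm, ContinuousMap.dist_lt_iff hε]
  intro z
  rw [dist_eq_norm]
  have h1 := norm_sub_le_norm_sub_add_norm_sub
    ((∏ j ∈ Finset.range n, ω (f^[j] z)) * g.1 ⟨f^[n] z, hΩ z z.2⟩) (denseSeq C(ℂ, ℂ) k z) (F z)
  have h2 := hb z z.2
  have h3 := hk z z.2
  exact h1.trans_lt (by linarith)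

theorem isOpen_setOf_approximatedByOrbit (hf : Continuous f) (hM : IsCompact M)
    (hω : ContinuousOn ω (forwardOrbit f M)) {Ω : Set ℂ} (hΩ : ∀ z ∈ M, ∀ n : ℕ, f^[n] z ∈ Ω)
    (F : C(ℂ, ℂ)) {ε : ℝ} (hε : 0 < ε) :
    IsOpen {g : HolFun Ω | ApproximatedByOrbit f ω M g F ε} := by
  have : CompactSpace M := isCompact_iff_compactSpace.1 hM
  let w (n : ℕ) : C(M, ℂ) := ⟨fun z => ∏ j ∈ Finset.range n, ω (f^[j] z),
    continuousOn_iff_continuous_domRestrict.1 (continuousOn_weight hf hω n)⟩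
  let i (n : ℕ) : C(M, Ω) := ⟨fun z => ⟨f^[n] z, hΩ z z.2 n⟩,
    ((hf.iterate n).comp continuous_subtype_val).subtype_mk _⟩
  have : {g : HolFun Ω | ApproximatedByOrbit f ω M g F ε} =
      ⋃ n : ℕ, ⋃ _ : 1 ≤ n, {g : HolFun Ω | ‖w n * g.1.comp (i n) - F.restrict M‖ < ε} := by
    ext g
    simp only [mem_ofPred_eq, mem_iUnion, exists_prop, ContinuousMap.norm_lt_iff _ hε]
    refine exists_congr fun n => and_congr_right fun _ => ?_
    exact ⟨fun h z => (h z z.2).2, fun h z hz => ⟨hΩ z hz n, h ⟨z, hz⟩⟩⟩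
  rw [this]
  refine isOpen_iUnion fun n => isOpen_iUnion fun _ => isOpen_lt ?_ continuous_const
  exact ((continuous_const.mul ((ContinuousMap.continuous_precomp (i n)).comp
    continuous_subtype_val)).sub continuous_const).norm

theorem dense_setOf_approximatedByOrbit (hf : Continuous f) (hM : IsCompact M)
    (hω : ContinuousOn ω (forwardOrbit f M)) (hω0 : ∀ z ∈ forwardOrbit f M, ω z ≠ 0)
    (hne : ∀ z ∈ M, ∀ n : ℕ, f^[n] z ≠ z₀)
    (hlim : ∀ ε > 0, ∀ᶠ n in atTop, ∀ z ∈ M, ‖f^[n] z - z₀‖ < ε)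
    (hA : HasEntireApproximation f z₀ M) (F : C(ℂ, ℂ)) {ε : ℝ} (hε : 0 < ε) :
    Dense {g : HolFun ({z₀}ᶜ : Set ℂ) | ApproximatedByOrbit f ω M g F ε} := by
  have : CompactSpace M := isCompact_iff_compactSpace.1 hM
  intro g
  refine HolFun.mem_closure_of_addEntire fun m => ?_
  obtain ⟨n, hn, hnm⟩ := ((eventually_ge_atTop 1).and
    (hlim (1 / ((m : ℝ) + 1)) (by positivity))).exists
  set w : ℂ → ℂ := fun z => ∏ j ∈ Finset.range n, ω (f^[j] z) with hw
  have hwc : ContinuousOn w M := continuousOn_weight hf hω n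
  have hw0 : ∀ z ∈ M, w z ≠ 0 := fun z hz =>
    Finset.prod_ne_zero_iff.2 fun j _ => hω0 _ (mem_iUnion.2 ⟨j, z, hz, rfl⟩)
  obtain ⟨C, hC⟩ := hM.exists_bound_of_continuousOn hwc
  -- This is the value that `Q (f^[n] z - z₀)⁻¹` should take for the corrected `g` to hit `F`
  -- exactly. It is continuous because the weight `w` has no zeros on `M`.
  have hP : Continuous fun z : M => F z / w z - g.1 ⟨f^[n] z, hne z z.2 n⟩ :=
    ((F.continuous.comp continuous_subtype_val).div
      (continuousOn_iff_continuous_domRestrict.1 hwc) fun z => hw0 z z.2).sub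
      (g.1.continuous.comp (((hf.iterate n).comp continuous_subtype_val).subtype_mk _))
  obtain ⟨G, hG⟩ := ContinuousMap.exists_restrict_eq hM.isClosed ⟨_, hP⟩
  have hG' : ∀ z (hz : z ∈ M), G z = F z / w z - g.1 ⟨f^[n] z, hne z hz n⟩ := fun z hz =>
    DFunLike.congr_fun hG ⟨z, hz⟩
  have hC1 : 0 < |C| + 1 := by positivity
  obtain ⟨Q, hQ, hQ1, hQ2⟩ := hA n m (fun z hz => by
    have h1 := hnm z hz
    rw [lt_div_iff₀ (by positivity)] at h1
    nlinarith [norm_nonneg (f^[n] z - z₀)]) G (min (1 / ((m : ℝ) + 1)) (ε / (|C| + 1)))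
    (lt_min (by positivity) (by positivity))
  refine ⟨Q, hQ, fun ζ hζ => (hQ1 ζ hζ).trans_le (min_le_left _ _), n, hn, fun z hz =>
    ⟨hne z hz n, ?_⟩⟩
  rw [HolFun.addEntire_apply]
  have h1 : w z * (g.1 ⟨f^[n] z, hne z hz n⟩ + Q (f^[n] z - z₀)⁻¹) - F z =
      w z * (Q (f^[n] z - z₀)⁻¹ - G z) := by
    rw [hG' z hz]
    have := hw0 z hz
    field_simp; ring
  change ‖w z * (g.1 ⟨f^[n] z, hne z hz n⟩ + Q (f^[n] z - z₀)⁻¹) - F z‖ < ε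
  rw [h1, norm_mul]
  have h2 := (hQ2 z hz).trans_le (min_le_right _ _)
  rw [lt_div_iff₀ hC1] at h2
  nlinarith [hC z hz, le_abs_self C, norm_nonneg (Q (f^[n] z - z₀)⁻¹ - G z), norm_nonneg (w z)]

theorem eventually_approximatedByOrbit (hf : Continuous f) (hM : IsCompact M)
    (hω : ContinuousOn ω (forwardOrbit f M)) (hω0 : ∀ z ∈ forwardOrbit f M, ω z ≠ 0)
    (hne : ∀ z ∈ M, ∀ n : ℕ, f^[n] z ≠ z₀)
    (hlim : ∀ ε > 0, ∀ᶠ n in atTop, ∀ z ∈ M, ‖f^[n] z - z₀‖ < ε)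
    (hA : HasEntireApproximation f z₀ M) :
    ∀ᶠ g in residual (HolFun ({z₀}ᶜ : Set ℂ)), ∀ k j : ℕ,
      ApproximatedByOrbit f ω M g (denseSeq C(ℂ, ℂ) k) (1 / ((j : ℝ) + 1)) := by
  refine eventually_countable_forall.2 fun k => eventually_countable_forall.2 fun j => ?_
  have hj : 0 < 1 / ((j : ℝ) + 1) := by positivity
  exact residual_of_dense_open (isOpen_setOf_approximatedByOrbit hf hM hω hne _ hj)
    (dense_setOf_approximatedByOrbit hf hM hω hω0 hne hlim hA _ hj)

end weights

/-! ### Comeagre families of compact sets -/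

namespace IsBottcherCoordinate

variable {f : ℂ → ℂ} {z₀ : ℂ} {U V : Set ℂ} {φ : ℂ → ℂ} {r : ℝ}

theorem eventually_planeSet_subset (hφ : IsBottcherCoordinate f z₀ U V φ) (hr : 0 < r) :
    ∀ᶠ K in residual (NonemptyCompacts (bottcherNhd U φ r)),
      planeSet K ⊆ puncturedNhd U φ r :=
  residual_of_dense_open (isOpen_setOf_planeSet_subset (hφ.isOpen_puncturedNhd r))
    ((hφ.dense_finite_injOn hr).mono fun _ hK => hK.2.1)

theorem hasEntireApproximation_of_injOn (hφ : IsBottcherCoordinate f z₀ U V φ)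
    (hp : localDegree f z₀ ≠ 0) {M : Set ℂ} (hM : M.Finite) (hMr : M ⊆ puncturedNhd U φ r)
    (hi : InjOn (fun z => ‖φ z‖) M) : HasEntireApproximation f z₀ M :=
  hasEntireApproximation_of_finite hM (hφ.injOn_iterate hp (fun _ hz => (hMr hz).1) hi)
    fun _ hz => hφ.iterate_ne (hMr hz)

theorem eventually_hasEntireApproximation (hφ : IsBottcherCoordinate f z₀ U V φ)
    (hf : Continuous f) (hp : localDegree f z₀ ≠ 0) (hr : 0 < r) :
    ∀ᶠ K in residual (NonemptyCompacts (bottcherNhd U φ r)),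
      HasEntireApproximation f z₀ (planeSet K) := by
  let B := bottcherNhd U φ r
  let O (n m : ℕ) : Set ℂ := puncturedNhd U φ r ∩ {z | ‖f^[n] z - z₀‖ * m < 1}
  have hO : ∀ n m, IsOpen (O n m) := fun n m =>
    (hφ.isOpen_puncturedNhd r).inter (isOpen_lt
      (((hf.iterate n).sub continuous_const).norm.mul continuous_const) continuous_const)
  let A (Q : ℂ → ℂ) (n k j : ℕ) : Set ℂ := puncturedNhd U φ r ∩
    {z | ‖Q (f^[n] z - z₀)⁻¹ - denseSeq C(ℂ, ℂ) k z‖ < 1 / ((j : ℝ) + 1)}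
  have hA : ∀ Q, Differentiable ℂ Q → ∀ n k j, IsOpen (A Q n k j) := by
    intro Q hQ n k j
    have hc : ContinuousOn (fun z => ‖Q (f^[n] z - z₀)⁻¹ - denseSeq C(ℂ, ℂ) k z‖)
        (puncturedNhd U φ r) :=
      ((hQ.continuous.comp_continuousOn
        (((hf.iterate n).sub continuous_const).continuousOn.inv₀
          fun z hz => sub_ne_zero.2 (hφ.iterate_ne hz n))).sub
        (denseSeq C(ℂ, ℂ) k).continuous.continuousOn).norm
    exact hc.isOpen_inter_preimage (hφ.isOpen_puncturedNhd r) isOpen_Iio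
  -- The union runs over uncountably many `Q`, which is harmless for openness; only the indices `n m
  -- k j` must be countable.
  let T (n m k j : ℕ) : Set (NonemptyCompacts B) := {K | ∃ Q : ℂ → ℂ, Differentiable ℂ Q ∧
    (∀ ζ, ‖ζ‖ ≤ m → ‖Q ζ‖ < 1 / ((j : ℝ) + 1)) ∧ planeSet K ⊆ A Q n k j}
  have hT : ∀ n m k j, IsOpen (T n m k j) := by
    intro n m k j
    have : T n m k j = ⋃ Q : ℂ → ℂ, ⋃ _ : Differentiable ℂ Q ∧
        (∀ ζ, ‖ζ‖ ≤ m → ‖Q ζ‖ < 1 / ((j : ℝ) + 1)), {K | planeSet K ⊆ A Q n k j} := by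
      ext K; simp [T, and_assoc]
    rw [this]
    exact isOpen_iUnion fun Q => isOpen_iUnion fun hQ =>
      isOpen_setOf_planeSet_subset (hA Q hQ.1 n k j)
  have hres : ∀ᶠ K in residual (NonemptyCompacts B), ∀ n m k j : ℕ,
      planeSet K ⊆ O n m → K ∈ T n m k j := by
    simp only [eventually_countable_forall]
    intro n m k j
    refine eventually_residual_imp (S := {K | planeSet K ⊆ O n m}) (hT n m k j) ?_
    refine ((hφ.dense_finite_injOn hr).open_subset_closure_inter
      (isOpen_setOf_planeSet_subset (hO n m))).trans (closure_mono ?_)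
    rintro K ⟨hKO, hKf, hKr, hKi⟩
    obtain ⟨Q, hQ, h1, h2⟩ := hφ.hasEntireApproximation_of_injOn hp hKf hKr hKi n m
      (fun z hz => (hKO hz).2) (denseSeq C(ℂ, ℂ) k) (1 / ((j : ℝ) + 1)) (by positivity)
    exact ⟨Q, hQ, h1, fun z hz => ⟨hKr hz, h2 z hz⟩⟩
  filter_upwards [hres, hφ.eventually_planeSet_subset hr] with K hK hKr
  refine .of_seq (isCompact_planeSet K) fun n m k j h => ?_
  obtain ⟨Q, hQ, h1, h2⟩ := hK n m k j fun z hz => ⟨hKr hz, h z hz⟩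
  exact ⟨Q, hQ, h1, fun z hz => (h2 hz).2⟩

theorem isOpen_setOf_planeSet_approximatedByOrbit (hφ : IsBottcherCoordinate f z₀ U V φ)
    (hf : Continuous f) {ω : ℂ → ℂ}
    (hω : ContinuousOn ω (forwardOrbit f (puncturedNhd U φ r)))
    (g : HolFun ({z₀}ᶜ : Set ℂ)) (F : C(ℂ, ℂ)) (ε : ℝ) :
    IsOpen {K : NonemptyCompacts (bottcherNhd U φ r) | planeSet K ⊆ puncturedNhd U φ r ∧
      ApproximatedByOrbit f ω (planeSet K) g F ε} := by
  obtain ⟨G, hG, hgG⟩ := g.2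
  let A (n : ℕ) : Set ℂ := puncturedNhd U φ r ∩
    {z | ‖(∏ j ∈ Finset.range n, ω (f^[j] z)) * G (f^[n] z) - F z‖ < ε}
  have hA : ∀ n, IsOpen (A n) := by
    intro n
    have hc : ContinuousOn
        (fun z => ‖(∏ j ∈ Finset.range n, ω (f^[j] z)) * G (f^[n] z) - F z‖)
        (puncturedNhd U φ r) :=
      (((continuousOn_weight hf hω n).mul (hG.continuousOn.comp (hf.iterate n).continuousOn
        fun z hz => hφ.iterate_ne hz n)).sub F.continuous.continuousOn).norm
    exact hc.isOpen_inter_preimage (hφ.isOpen_puncturedNhd r) isOpen_Iio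
  have : {K : NonemptyCompacts (bottcherNhd U φ r) | planeSet K ⊆ puncturedNhd U φ r ∧
      ApproximatedByOrbit f ω (planeSet K) g F ε} =
      ⋃ n : ℕ, ⋃ _ : 1 ≤ n, {K | planeSet K ⊆ A n} := by
    ext K
    simp only [mem_ofPred_eq, mem_iUnion, exists_prop]
    constructor
    · rintro ⟨hK, n, hn, h⟩
      refine ⟨n, hn, fun z hz => ⟨hK hz, ?_⟩⟩
      obtain ⟨h1, h2⟩ := h z hz
      rwa [hgG] at h2
    · rintro ⟨n, hn, h⟩
      refine ⟨fun z hz => (h hz).1, n, hn, fun z hz => ⟨hφ.iterate_ne (h hz).1 n, ?_⟩⟩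
      rw [hgG]
      exact (h hz).2
  rw [this]
  exact isOpen_iUnion fun n => isOpen_iUnion fun _ => isOpen_setOf_planeSet_subset (hA n)

theorem eventually_forall_approximatedByOrbit (hφ : IsBottcherCoordinate f z₀ U V φ)
    (hf : Continuous f) (hp : 2 ≤ localDegree f z₀) (hr1 : r ≤ 1) {M : Set ℂ}
    (hM : IsCompact M) (hMr : M ⊆ puncturedNhd U φ r) (hA : HasEntireApproximation f z₀ M)
    {ω : ℂ → ℂ} (hω : ContinuousOn ω (forwardOrbit f M))
    (hω0 : ∀ z ∈ forwardOrbit f M, ω z ≠ 0) :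
    ∀ᶠ g in residual (HolFun ({z₀}ᶜ : Set ℂ)), ∀ k j : ℕ,
      ApproximatedByOrbit f ω M g (denseSeq C(ℂ, ℂ) k) (1 / ((j : ℝ) + 1)) :=
  eventually_approximatedByOrbit hf hM hω hω0 (fun _ hz => hφ.iterate_ne (hMr hz))
    (fun _ hε => hφ.eventually_iterate_near hr1 hp hM hMr hε) hA

end IsBottcherCoordinate

theorem mainTheorem10 (f : ℂ → ℂ) (z₀ : ℂ) (hf : IsTranscendentalEntire f)
    (hz₀ : IsSuperattractingFixedPt f z₀) (U V : Set ℂ) (φ : ℂ → ℂ)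
    (hφ : IsBottcherCoordinate f z₀ U V φ) (r : ℝ) (hr : 0 < r)
    (hrV : Metric.closedBall (0 : ℂ) r ⊆ V) :
    -- comeagre many compact sets first, then the weight, then comeagre many functions
    (∀ᶠ K in residual (NonemptyCompacts (bottcherNhd U φ r)),
      planeSet K ⊆ interior (bottcherNhd U φ r) \ {z₀} ∧
      ∀ ω : ℂ → ℂ, ContinuousOn ω (forwardOrbit f (planeSet K)) →
        (∀ z ∈ forwardOrbit f (planeSet K), ω z ≠ 0) →
        ∀ᶠ g in residual (HolFun ({z₀}ᶜ : Set ℂ)),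
          IsUniversalFor f ω (planeSet K) Set.univ g) ∧
    -- the weight first, then comeagre many functions, then comeagre many compact sets
    (∀ ω : ℂ → ℂ, ContinuousOn ω (interior (bottcherNhd U φ r) \ {z₀}) →
      (∀ z ∈ interior (bottcherNhd U φ r) \ {z₀}, ω z ≠ 0) →
      ∀ᶠ g in residual (HolFun ({z₀}ᶜ : Set ℂ)),
        ∀ᶠ K in residual (NonemptyCompacts (bottcherNhd U φ r)),
          planeSet K ⊆ interior (bottcherNhd U φ r) \ {z₀} ∧
          IsUniversalFor f ω (planeSet K) Set.univ g) := by
  have hfc : Continuous f := hf.1.continuous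
  have hp := hφ.two_le_localDegree hz₀
  have hp0 : localDegree f z₀ ≠ 0 := by omega
  have hr1 := hφ.radius_le_one hf hz₀ hrV
  constructor
  · filter_upwards [hφ.eventually_planeSet_subset hr,
      hφ.eventually_hasEntireApproximation hfc hp0 hr] with K hKr hKA
    refine ⟨hKr.trans (hφ.puncturedNhd_subset r), fun ω hω hω0 => ?_⟩
    filter_upwards [hφ.eventually_forall_approximatedByOrbit hfc hp hr1 (isCompact_planeSet K) hKr
      hKA hω hω0] with g hg
    exact isUniversalFor_of_seq hfc (isCompact_planeSet K) hω hg
  · intro ω hω hω0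
    have horb : ∀ M ⊆ puncturedNhd U φ r,
        forwardOrbit f M ⊆ interior (bottcherNhd U φ r) \ {z₀} := by
      intro M hM z hz
      obtain ⟨n, x, hx, rfl⟩ := mem_iUnion.1 hz
      exact hφ.puncturedNhd_subset r (hφ.iterate_mem_puncturedNhd hr1 hp0 (hM hx) n)
    -- Comeagreness in `g` survives only countably many requirements, so `g` is fixed by its
    -- behaviour on a countable dense family. Openness in `K` then extends this to comeagre many
    -- `K`.
    obtain ⟨𝓒, h𝓒, h𝓒c, h𝓒d⟩ :=
      Dense.exists_countable_dense_subset (hφ.dense_finite_injOn (r := r) hr)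
    have hg : ∀ᶠ g in residual (HolFun ({z₀}ᶜ : Set ℂ)), ∀ K ∈ 𝓒, ∀ k j : ℕ,
        ApproximatedByOrbit f ω (planeSet K) g (denseSeq C(ℂ, ℂ) k) (1 / ((j : ℝ) + 1)) := by
      rw [eventually_countable_ball h𝓒c]
      intro K hK
      obtain ⟨hKf, hKr, hKi⟩ := h𝓒 hK
      exact hφ.eventually_forall_approximatedByOrbit hfc hp hr1 (isCompact_planeSet K) hKr
        (hφ.hasEntireApproximation_of_injOn hp0 hKf hKr hKi) (hω.mono (horb _ hKr))
        fun z hz => hω0 z (horb _ hKr hz)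
    filter_upwards [hg] with g hg
    have hK : ∀ᶠ K in residual (NonemptyCompacts (bottcherNhd U φ r)), ∀ k j : ℕ,
        planeSet K ⊆ puncturedNhd U φ r ∧
        ApproximatedByOrbit f ω (planeSet K) g (denseSeq C(ℂ, ℂ) k) (1 / ((j : ℝ) + 1)) := by
      simp only [eventually_countable_forall]
      intro k j
      exact residual_of_dense_open (hφ.isOpen_setOf_planeSet_approximatedByOrbit hfc
        (hω.mono (horb _ subset_rfl)) g _ _) (h𝓒d.mono fun K hK => ⟨(h𝓒 hK).2.1, hg K hK k j⟩)
    filter_upwards [hK] with K hK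
    have hKr := (hK 0 0).1
    exact ⟨hKr.trans (hφ.puncturedNhd_subset r), isUniversalFor_of_seq hfc (isCompact_planeSet K)
      (hω.mono (horb _ hKr)) fun k j => (hK k j).2⟩
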